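/- Let $\Bbbk$ be an algebraically closed field of characteristic zero and let $G$ be a finite group. Let $D(G)$ be the Drinfel'd double of $G$ over $\Bbbk$: the Hopf algebra with $\Bbbk$-basis $\{e_g\# h : g,h\in G\}$, multiplication $(e_g\# g')(e_h\# h')=\delta_{g,\,g'hg'^{-1}}\,e_g\# g'h'$, unit $\sum_{g\in G}e_g\# 1$, comultiplication $\Delta(e_g\# h)=\sum_{xy=g}(e_y\# h)\otimes(e_x\# h)$, counit $\varepsilon(e_g\# h)=\delta_{g,1}$ and antipode $S(e_g\# h)=e_{h^{-1}g^{-1}h}\# h^{-1}$. Let $\operatorname{Aut}(D(G))$ be the group of Hopf algebra automorphisms of $D(G)$ under composition. Let $\operatorname{BCh}(G)$ be the group, under pointwise multiplication, of bicharacters $G\times G\to\Bbbk^\times$; a bicharacter is written as a homomorphism $r\colon h\mapsto r(h)$ from $G$ to the group $\widehat G$ of linear characters $G\to\Bbbk^\times$. The group $\operatorname{Aut}(G)$ acts on $\operatorname{BCh}(G)$ from the right by $r^v=v^*rv$, that is, $r^v(h)(g)=r(v(h))(v(g))$, and hence from the left by $v\cdot r=r^{v^{-1}}$; let $\operatorname{BCh}(G)\rtimes\operatorname{Aut}(G)$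 be the corresponding semidirect product. If $Z(G)=1$, then $$\operatorname{Aut}(D(G))\cong \operatorname{BCh}(G)\rtimes\operatorname{Aut}(G).$$ More precisely, there is a group isomorphism $\Phi\colon\operatorname{BCh}(G)\rtimes\operatorname{Aut}(G)\to\operatorname{Aut}(D(G))$ such that, for all $g,h\in G$, each $v\in\operatorname{Aut}(G)$ is sent to the automorphism $e_g\# h\mapsto e_{v(g)}\# v(h)$, each $r\in\operatorname{BCh}(G)$ is sent to the automorphism $e_g\# h\mapsto r(h)e_g\# h=r(h)(g)\,e_g\# h$, and $\Phi(v)^{-1}\,\Phi(r)\,\Phi(v)=\Phi(r^v)$ for all $r\in\operatorname{BCh}(G)$ and $v\in\operatorname{Aut}(G)$. -/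

import Mathlib

open scoped TensorProduct

noncomputable section

/-- The underlying vector space of the Drinfel'd double `D(G)` of a group `G` over `k`: the
`k`-vector space with basis the symbols `e_g # h`, indexed by the pairs `(g, h) ∈ G × G`. -/
def DrinfeldDouble (k G : Type*) [Field k] : Type _ := (G × G) →₀ k

namespace DrinfeldDouble

instance instAddCommGroup (k G : Type*) [Field k] : AddCommGroup (DrinfeldDouble k G) :=
  inferInstanceAs (AddCommGroup ((G × G) →₀ k))

instance instModule (k G : Type*) [Field k] : Module k (DrinfeldDouble k G) :=
  inferInstanceAs (Module k ((G × G) →₀ k))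

/-- The basis of the elements `e_g # h`. -/
def basis (k G : Type*) [Field k] : Module.Basis (G × G) k (DrinfeldDouble k G) :=
  Module.Basis.ofRepr (LinearEquiv.refl k ((G × G) →₀ k))

/-- The element `e_g # h` of the Drinfel'd double. -/
def elt (k : Type*) {G : Type*} [Field k] (g h : G) : DrinfeldDouble k G := basis k G (g, h)

theorem lin_ext {k G M : Type*} [Field k] [AddCommMonoid M] [Module k M]
    {f f' : DrinfeldDouble k G →ₗ[k] M} (H : ∀ g h, f (elt k g h) = f' (elt k g h)) : f = f' :=
  (basis k G).ext fun x => H x.1 x.2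

open Classical in
/-- The multiplication, determined bilinearly by
`(e_g # g') (e_h # h') = δ_{g, g' h g'⁻¹} e_g # g'h'`. -/
def mulMap (k G : Type*) [Field k] [Group G] :
    DrinfeldDouble k G →ₗ[k] DrinfeldDouble k G →ₗ[k] DrinfeldDouble k G :=
  (basis k G).constr k fun x => (basis k G).constr k fun y =>
    if x.1 = x.2 * y.1 * x.2⁻¹ then elt k x.1 (x.2 * y.2) else 0

instance instMul (k G : Type*) [Field k] [Group G] : Mul (DrinfeldDouble k G) :=
  ⟨fun a b => mulMap k G a b⟩

/-- The identity `ε # 1 = ∑_g e_g # 1`. -/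
instance instOne (k G : Type*) [Field k] [Group G] [Fintype G] : One (DrinfeldDouble k G) :=
  ⟨∑ g : G, elt k g 1⟩

theorem mul_def {k G : Type*} [Field k] [Group G] (a b : DrinfeldDouble k G) :
    a * b = mulMap k G a b := rfl

theorem one_def {k G : Type*} [Field k] [Group G] [Fintype G] :
    (1 : DrinfeldDouble k G) = ∑ g : G, elt k g 1 := rfl

open Classical in
theorem mulMap_elt {k G : Type*} [Field k] [Group G] (g g' h h' : G) :
    mulMap k G (elt k g g') (elt k h h') =
      if g = g' * h * g'⁻¹ then elt k g (g' * h') else 0 := by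
  simp [mulMap, elt]

theorem mulMap_assoc {k G : Type*} [Field k] [Group G] (a b c : DrinfeldDouble k G) :
    mulMap k G (mulMap k G a b) c = mulMap k G a (mulMap k G b c) := by
  have key : (mulMap k G).compr₂ (mulMap k G) =
      (LinearMap.llcomp k (DrinfeldDouble k G) (DrinfeldDouble k G) (DrinfeldDouble k G)).compl₁₂
        (mulMap k G) (mulMap k G) := by
    refine lin_ext fun g g' => lin_ext fun h h' => lin_ext fun l l' => ?_
    simp only [LinearMap.compr₂_apply, LinearMap.compl₁₂_apply, LinearMap.llcomp_apply, mulMap_elt]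
    by_cases h1 : g = g' * h * g'⁻¹ <;> by_cases h2 : h = h' * l * h'⁻¹
    · subst h2; subst h1; simp [mulMap_elt, mul_assoc]
    · have : ¬ g = g' * h' * l * (g' * h')⁻¹ := by
        intro h3; apply h2
        rw [h1] at h3
        have h4 : h = g'⁻¹ * (g' * h' * l * (g' * h')⁻¹) * g' := by rw [← h3]; group
        rw [h4]; group
      rw [if_pos h1, if_neg h2, mulMap_elt, if_neg this, map_zero]
    · subst h2
      simp [mulMap_elt, h1]
    · simp [h1, h2]
  exact LinearMap.congr_fun (LinearMap.congr_fun (LinearMap.congr_fun key a) b) c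

theorem mulMap_one_left {k G : Type*} [Field k] [Group G] [Fintype G] (a : DrinfeldDouble k G) :
    mulMap k G 1 a = a := by
  classical
  have key : mulMap k G 1 = LinearMap.id := by
    refine lin_ext fun h h' => ?_
    simp [one_def, mulMap_elt]
  exact LinearMap.congr_fun key a

theorem mulMap_one_right {k G : Type*} [Field k] [Group G] [Fintype G] (a : DrinfeldDouble k G) :
    mulMap k G a 1 = a := by
  classical
  have key : (mulMap k G).flip 1 = LinearMap.id := by
    refine lin_ext fun h h' => ?_
    have : ∀ x : G, h = h' * x * h'⁻¹ ↔ x = h'⁻¹ * h * h' := fun x => by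
      constructor <;> rintro rfl <;> group
    simp [one_def, mulMap_elt, this]
  exact LinearMap.congr_fun key a

instance instRing (k G : Type*) [Field k] [Group G] [Fintype G] : Ring (DrinfeldDouble k G) :=
  { instAddCommGroup k G, instMul k G, instOne k G with
    left_distrib := fun a b c => map_add (mulMap k G a) b c
    right_distrib := fun a b c => by simp [mul_def]
    zero_mul := fun a => by simp [mul_def]
    mul_zero := fun a => by simp [mul_def]
    mul_assoc := mulMap_assoc
    one_mul := mulMap_one_left
    mul_one := mulMap_one_right }

instance instAlgebra (k G : Type*) [Field k] [Group G] [Fintype G] :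
    Algebra k (DrinfeldDouble k G) :=
  Algebra.ofModule (fun r x y => by simp [mul_def]) (fun r x y => by simp [mul_def])

open Classical in
theorem elt_mul_elt {k G : Type*} [Field k] [Group G] [Fintype G] (g g' h h' : G) :
    elt k g g' * elt k h h' = if g = g' * h * g'⁻¹ then elt k g (g' * h') else 0 :=
  mulMap_elt g g' h h'

open Classical in
/-- The tensor product coalgebra structure of `(k^G)^cop ⊗ kG`. The comultiplication of `k^G` is
`e_g ↦ ∑_{xy = g} e_x ⊗ e_y`, and its counit is `e_g ↦ δ_{g,1}`; hence on `D(G)` we have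
`Δ(e_g # h) = ∑_{xy = g} (e_y # h) ⊗ (e_x # h)` and `ε(e_g # h) = δ_{g,1}`. In the sum over all
`x`, the element `y` is `x⁻¹ g`. -/
instance instCoalgebraStruct (k G : Type*) [Field k] [Group G] [Fintype G] :
    CoalgebraStruct k (DrinfeldDouble k G) where
  comul := (basis k G).constr k fun p => ∑ x : G, elt k (x⁻¹ * p.1) p.2 ⊗ₜ[k] elt k x p.2
  counit := (basis k G).constr k fun p => if p.1 = 1 then 1 else 0

theorem comul_elt {k G : Type*} [Field k] [Group G] [Fintype G] (g h : G) :
    CoalgebraStruct.comul (R := k) (elt k g h) =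
      ∑ x : G, elt k (x⁻¹ * g) h ⊗ₜ[k] elt k x h := by
  exact (basis k G).constr_basis k _ (g, h)

open Classical in
theorem counit_elt {k G : Type*} [Field k] [Group G] [Fintype G] (g h : G) :
    CoalgebraStruct.counit (R := k) (elt k g h) = if g = 1 then 1 else 0 := by
  exact (basis k G).constr_basis k _ (g, h)

instance instCoalgebra (k G : Type*) [Field k] [Group G] [Fintype G] :
    Coalgebra k (DrinfeldDouble k G) where
  coassoc := by
    classical
    refine lin_ext fun g h => ?_
    simp only [LinearMap.comp_apply, comul_elt, map_sum, LinearMap.rTensor_tmul,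
      LinearMap.lTensor_tmul, TensorProduct.sum_tmul, TensorProduct.tmul_sum,
      LinearEquiv.coe_coe, TensorProduct.assoc_tmul]
    -- left: `∑ x, ∑ y, (y⁻¹x⁻¹g) ⊗ y ⊗ x`; right: `∑ z, ∑ x, (z⁻¹g) ⊗ (x⁻¹z) ⊗ x`, with `z = xy`
    rw [Finset.sum_comm (f := fun z x => elt k (z⁻¹ * g) h ⊗ₜ[k] (elt k (x⁻¹ * z) h ⊗ₜ[k] elt k x h))]
    refine Finset.sum_congr rfl fun x _ => Fintype.sum_equiv (Equiv.mulLeft x) _ _ fun y => ?_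
    simp [mul_assoc]
  rTensor_counit_comp_comul := by
    classical
    refine lin_ext fun g h => ?_
    have : ∀ x : G, x⁻¹ * g = 1 ↔ x = g := fun x => by rw [inv_mul_eq_one]
    simp [comul_elt, counit_elt, this, TensorProduct.ite_tmul]
  lTensor_counit_comp_comul := by
    classical
    refine lin_ext fun g h => ?_
    simp [comul_elt, counit_elt, TensorProduct.tmul_ite]

instance instBialgebra (k G : Type*) [Field k] [Group G] [Fintype G] :
    Bialgebra k (DrinfeldDouble k G) where
  counit_one := by classical simp [one_def, counit_elt]
  mul_compr₂_counit := by
    refine lin_ext fun g g' => lin_ext fun h h' => ?_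
    simp only [LinearMap.compr₂_apply, LinearMap.compl₁₂_apply, LinearMap.mul_apply', elt_mul_elt,
      counit_elt]
    by_cases h1 : h = 1
    · subst h1; by_cases h2 : g = 1 <;> simp [h2, counit_elt]
    · by_cases h3 : g = g' * h * g'⁻¹
      · subst h3; simp [counit_elt, h1]
      · simp [h1, h3]
  comul_one := by
    simp only [one_def, map_sum, comul_elt, Algebra.TensorProduct.one_def,
      TensorProduct.sum_tmul, TensorProduct.tmul_sum]
    rw [Finset.sum_comm]
    refine Finset.sum_congr rfl fun x _ => Fintype.sum_equiv (Equiv.mulLeft x⁻¹) _ _ fun y => ?_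
    simp
  mul_compr₂_comul := by
    classical
    refine lin_ext fun g g' => lin_ext fun h h' => ?_
    simp only [LinearMap.compr₂_apply, LinearMap.compl₁₂_apply, LinearMap.mul_apply', elt_mul_elt,
      comul_elt, Finset.sum_mul_sum, Algebra.TensorProduct.tmul_mul_tmul]
    -- only the pairs `(x, y)` with `x = g' y g'⁻¹` contribute
    rw [Finset.sum_comm]
    have inner : ∀ y : G, ∑ x : G,
        (if x⁻¹ * g = g' * (y⁻¹ * h) * g'⁻¹ then elt k (x⁻¹ * g) (g' * h') else 0) ⊗ₜ[k]
          (if x = g' * y * g'⁻¹ then elt k x (g' * h') else 0) =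
        if g = g' * h * g'⁻¹ then
          elt k ((g' * y * g'⁻¹)⁻¹ * g) (g' * h') ⊗ₜ[k] elt k (g' * y * g'⁻¹) (g' * h')
        else 0 := by
      intro y
      rw [Finset.sum_eq_single (g' * y * g'⁻¹) (fun x _ hx => by simp [hx]) (by simp)]
      have : (g' * y * g'⁻¹)⁻¹ * g = g' * (y⁻¹ * h) * g'⁻¹ ↔ g = g' * h * g'⁻¹ := by
        rw [inv_mul_eq_iff_eq_mul]
        simp [mul_assoc]
      by_cases h1 : g = g' * h * g'⁻¹
      · rw [if_pos h1, if_pos (this.2 h1), if_pos rfl]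
      · rw [if_neg h1, if_neg (mt this.1 h1), TensorProduct.zero_tmul]
    simp only [inner]
    by_cases h1 : g = g' * h * g'⁻¹
    · simp only [if_pos h1, comul_elt]
      exact (Fintype.sum_equiv (MulAut.conj g').toEquiv _ _ fun y => by simp).symm
    · simp [if_neg h1]

/-- The antipode `S(e_g # h) = e_{h⁻¹ g⁻¹ h} # h⁻¹`. -/
def antipodeMap (k G : Type*) [Field k] [Group G] : DrinfeldDouble k G →ₗ[k] DrinfeldDouble k G :=
  (basis k G).constr k fun p => elt k (p.2⁻¹ * p.1⁻¹ * p.2) p.2⁻¹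

theorem antipodeMap_elt {k G : Type*} [Field k] [Group G] (g h : G) :
    antipodeMap k G (elt k g h) = elt k (h⁻¹ * g⁻¹ * h) h⁻¹ :=
  (basis k G).constr_basis k _ (g, h)

/-- The Hopf algebra `D(G)`, with antipode `S(e_g # h) = e_{h⁻¹ g⁻¹ h} # h⁻¹`. -/
instance instHopfAlgebra (k G : Type*) [Field k] [Group G] [Fintype G] :
    HopfAlgebra k (DrinfeldDouble k G) where
  antipode := antipodeMap k G
  mul_antipode_rTensor_comul := by
    classical
    refine lin_ext fun g h => ?_
    simp only [LinearMap.comp_apply, comul_elt, map_sum, LinearMap.rTensor_tmul, antipodeMap_elt,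
      LinearMap.mul'_apply, elt_mul_elt, counit_elt, Algebra.linearMap_apply]
    by_cases h1 : g = 1
    · subst h1
      simp only [if_true, map_one, one_def]
      refine Fintype.sum_equiv (MulAut.conj h⁻¹).toEquiv _ _ fun y => ?_
      simp
    · simp [h1]
  mul_antipode_lTensor_comul := by
    classical
    refine lin_ext fun g h => ?_
    simp only [LinearMap.comp_apply, comul_elt, map_sum, LinearMap.lTensor_tmul, antipodeMap_elt,
      LinearMap.mul'_apply, elt_mul_elt, counit_elt, Algebra.linearMap_apply]
    have e : ∀ x : G, h * (h⁻¹ * x⁻¹ * h) * h⁻¹ = x⁻¹ := fun x => by group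
    simp only [e]
    by_cases h1 : g = 1
    · subst h1
      simp only [if_true, map_one, one_def]
      refine Fintype.sum_equiv (Equiv.inv G) _ _ fun y => ?_
      simp
    · simp [h1]

/-- The group `Aut(D(G))` of automorphisms of the Hopf algebra `D(G)`, under composition
`f * f' = f ∘ f'`. (A bijective morphism of bialgebras between Hopf algebras automatically
respects the antipodes.) -/
instance instGroupAut (k G : Type*) [Field k] [Group G] [Fintype G] :
    Group (DrinfeldDouble k G ≃ₐc[k] DrinfeldDouble k G) where
  mul f f' := f'.trans f
  one := BialgEquiv.refl k (DrinfeldDouble k G)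
  inv f := f.symm
  mul_assoc _ _ _ := rfl
  one_mul _ := rfl
  mul_one _ := rfl
  inv_mul_cancel f := BialgEquiv.ext fun x => f.symm_apply_apply x

end DrinfeldDouble

/-- The group `BCh(G)` of bicharacters `G × G → kˣ` under pointwise multiplication; a bicharacter
`ω` is recorded as the homomorphism `r : h ↦ ω(h, ·)` from `G` to the group `Ĝ` of linear
characters of `G`. -/
abbrev BCh (k G : Type*) [Field k] [Group G] : Type _ := G →* (G →* kˣ)

/-- `r^v = v^* r v` for a bicharacter `r` and an automorphism `v`, where `v^*` is precomposition
of linear characters with `v`; that is, `r^v(h)(g) = r(v(h))(v(g))`. -/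
def BCh.twist {k G : Type*} [Field k] [Group G] (r : BCh k G) (v : MulAut G) : BCh k G :=
  ((MonoidHom.compHom' v.toMonoidHom).comp r).comp v.toMonoidHom

/-- The right action `r ↦ r^v` of `Aut(G)` on `BCh(G)`, turned into the left action
`v ↦ (r ↦ r^(v⁻¹))` in the usual way, so that it defines a semidirect product. -/
def BCh.action (k G : Type*) [Field k] [Group G] : MulAut G →* MulAut (BCh k G) where
  toFun v :=
    { toFun := fun r => r.twist v⁻¹
      invFun := fun r => r.twist v
      left_inv := fun r => by ext h g; simp [BCh.twist]
      right_inv := fun r => by ext h g; simp [BCh.twist]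
      map_mul' := fun r s => by ext h g; simp [BCh.twist] }
  map_one' := by ext r h g; simp [BCh.twist]
  map_mul' v w := by ext r h g; simp [BCh.twist]

end

open scoped TensorProduct

noncomputable section

/-! Surjectivity is the real content; it rests on the projection `π : D(G) → kG`, `e_g # h ↦ δ_{g,1}
h`. This map is cocentral, so for an automorphism `f` the value `π f(e_g # h)` depends only on the
conjugacy class of `g`. If `g ≠ 1`, trivial centre gives another conjugate `g'` of `g`; since `e_g #
1` and `e_{g'} # 1` are orthogonal idempotents, `π f(e_g # 1) = 0`.

Hence `f` respects the coaction `(id ⊗ π)Δ`, a grading of `D(G)` by the second index: there is a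
homomorphism `v` such that `f(e_g # h)` lies in the span of the `e_a # v(h)` (`exists_hom`). Then
`f` permutes the primitive idempotents `e_g # 1` by some `w`, so `f(e_g # h)` is a scalar `l g h`
times `e_{w g} # v h`. Compatibility with `Δ` and with products makes `w` multiplicative and
equivariant, so `w = v` because the centre is trivial; the same identities make `l` a bicharacter.
-/

theorem BCh.action_apply {k G : Type*} [Field k] [Group G] (v : MulAut G) (r : BCh k G) (h g : G) :
    BCh.action k G v r h g = r (v⁻¹ h) (v⁻¹ g) := rfl

/-- `b⁻¹ * a` is central. This is what finally identifies the two maps `w` and `v`. -/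
theorem eq_of_conj_eq {G : Type*} [Group G] (hG : Subgroup.center G = ⊥) {a b : G}
    (H : ∀ x, a * x * a⁻¹ = b * x * b⁻¹) : a = b := by
  have : b⁻¹ * a ∈ Subgroup.center G := Subgroup.mem_center_iff.2 fun x => by
    have := H x
    rw [mul_inv_eq_iff_eq_mul] at this
    calc x * (b⁻¹ * a) = b⁻¹ * (b * x * b⁻¹ * a) := by group
      _ = b⁻¹ * a * x := by rw [← this, mul_assoc]
  rw [hG, Subgroup.mem_bot, inv_mul_eq_one] at this
  exact this.symm

namespace DrinfeldDouble

variable {k G : Type*} [Field k]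

theorem elt_ne_zero (g h : G) : elt k g h ≠ 0 := (basis k G).ne_zero (g, h)

theorem repr_elt (a b c d : G) [Decidable (a = c ∧ b = d)] :
    (basis k G).repr (elt k a b) (c, d) = if a = c ∧ b = d then 1 else 0 := by
  classical
  simp [elt, Finsupp.single_apply]

/-! ### The automorphisms coming from pairs `(r, v)`. -/

variable [Group G]

/-- The linear endomorphism `e_g # h ↦ r(v h)(v g) e_{v g} # v h` of `D(G)` for a pair `(r, v)`. -/
def twistLin (p : BCh k G ⋊[BCh.action k G] MulAut G) : DrinfeldDouble k G →ₗ[k] DrinfeldDouble k G :=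
  (basis k G).constr k fun x =>
    (p.left (p.right x.2) (p.right x.1) : k) • elt k (p.right x.1) (p.right x.2)

theorem twistLin_elt (p : BCh k G ⋊[BCh.action k G] MulAut G) (g h : G) :
    twistLin p (elt k g h) =
      (p.left (p.right h) (p.right g) : k) • elt k (p.right g) (p.right h) :=
  (basis k G).constr_basis k _ (g, h)

/-- As `(r, v) = (r, 1)(1, v)` and the right factor acts first, `r` is evaluated at `(v h, v g)`;
the inverse in the left action then cancels in a composite. -/
theorem twistLin_mul (p q : BCh k G ⋊[BCh.action k G] MulAut G) (x : DrinfeldDouble k G) :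
    twistLin (p * q) x = twistLin p (twistLin q x) := by
  have : twistLin (p * q) = twistLin p ∘ₗ twistLin q := by
    refine lin_ext fun g h => ?_
    rw [LinearMap.comp_apply, twistLin_elt, twistLin_elt, map_smul, twistLin_elt, smul_smul]
    simp [BCh.action_apply, mul_comm]
  exact LinearMap.congr_fun this x

theorem twistLin_one (x : DrinfeldDouble k G) :
    twistLin (1 : BCh k G ⋊[BCh.action k G] MulAut G) x = x := by
  have : twistLin (1 : BCh k G ⋊[BCh.action k G] MulAut G) = LinearMap.id := by
    refine lin_ext fun g h => ?_
    simp [twistLin_elt]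
  exact LinearMap.congr_fun this x

section Fintype

variable [Fintype G]

theorem twistLin_map_one (p : BCh k G ⋊[BCh.action k G] MulAut G) : twistLin p 1 = 1 := by
  simp only [one_def, map_sum, twistLin_elt]
  exact Fintype.sum_equiv p.right.toEquiv _ _ fun g => by simp

theorem twistLin_map_mul (p : BCh k G ⋊[BCh.action k G] MulAut G) (x y : DrinfeldDouble k G) :
    twistLin p (x * y) = twistLin p x * twistLin p y := by
  classical
  have : (LinearMap.mul k (DrinfeldDouble k G)).compr₂ (twistLin p) =
      (LinearMap.mul k (DrinfeldDouble k G)).compl₁₂ (twistLin p) (twistLin p) := by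
    refine lin_ext fun g g' => lin_ext fun h h' => ?_
    simp only [LinearMap.compr₂_apply, LinearMap.compl₁₂_apply, LinearMap.mul_apply', elt_mul_elt,
      twistLin_elt, smul_mul_smul_comm, ← map_mul, ← map_inv, p.right.injective.eq_iff]
    by_cases H : g = g' * h * g'⁻¹
    · subst H
      rw [if_pos rfl, if_pos rfl, twistLin_elt]
      -- A linear character takes the same value on `h` and on its conjugate.
      congr 1
      simp
    · simp [H]
  exact LinearMap.congr_fun (LinearMap.congr_fun this x) y

/-- The Hopf algebra automorphism `e_g # h ↦ r(v h)(v g) e_{v g} # v h` of `D(G)`. -/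
def twistEquiv (p : BCh k G ⋊[BCh.action k G] MulAut G) :
    DrinfeldDouble k G ≃ₐc[k] DrinfeldDouble k G :=
  BialgEquiv.ofAlgEquiv
    (AlgEquiv.ofLinearEquiv
      (LinearEquiv.ofLinearMap (twistLin p) (twistLin p⁻¹)
        (LinearMap.ext fun x => by simp [← twistLin_mul, twistLin_one])
        (LinearMap.ext fun x => by simp [← twistLin_mul, twistLin_one]))
      (twistLin_map_one p) (twistLin_map_mul p))
    (AlgHom.toLinearMap_injective <| lin_ext fun g h => by
      classical
      change CoalgebraStruct.counit (R := k) (twistLin p (elt k g h)) =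
        CoalgebraStruct.counit (R := k) (elt k g h)
      by_cases hg : g = 1 <;> simp [twistLin_elt, counit_elt, hg])
    (AlgHom.toLinearMap_injective <| lin_ext fun g h => by
      change TensorProduct.map (twistLin p) (twistLin p)
          (CoalgebraStruct.comul (R := k) (elt k g h)) =
        CoalgebraStruct.comul (R := k) (twistLin p (elt k g h))
      simp only [twistLin_elt, comul_elt, map_sum, map_smul, TensorProduct.map_tmul,
        Finset.smul_sum]
      refine Fintype.sum_equiv p.right.toEquiv _ _ fun x => ?_
      rw [TensorProduct.smul_tmul_smul, ← Units.val_mul, mul_comm, ← map_mul, ← map_mul,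
        mul_inv_cancel_left]
      simp)

theorem bialgEquiv_ext {f f' : DrinfeldDouble k G ≃ₐc[k] DrinfeldDouble k G}
    (H : ∀ g h, f (elt k g h) = f' (elt k g h)) : f = f' :=
  BialgEquiv.ext fun x => LinearMap.congr_fun
    (lin_ext (f := (f : DrinfeldDouble k G →ₗ[k] DrinfeldDouble k G))
      (f' := (f' : DrinfeldDouble k G →ₗ[k] DrinfeldDouble k G)) H) x

variable (k G) in
/-- The homomorphism `BCh(G) ⋊ Aut(G) → Aut(D(G))`. -/
def twistHom : (BCh k G ⋊[BCh.action k G] MulAut G) →*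
    (DrinfeldDouble k G ≃ₐc[k] DrinfeldDouble k G) where
  toFun := twistEquiv
  map_one' := BialgEquiv.ext fun x => twistLin_one x
  map_mul' p q := BialgEquiv.ext fun x => twistLin_mul p q x

theorem twistHom_elt (p : BCh k G ⋊[BCh.action k G] MulAut G) (g h : G) :
    twistHom k G p (elt k g h) =
      (p.left (p.right h) (p.right g) : k) • elt k (p.right g) (p.right h) :=
  twistLin_elt p g h

theorem twistHom_injective : Function.Injective (twistHom k G) := by
  classical
  refine (injective_iff_map_eq_one _).2 fun p hp => ?_
  have key : ∀ g h, (p.left (p.right h) (p.right g) : k) • elt k (p.right g) (p.right h) =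
      elt k g h := fun g h => by rw [← twistHom_elt, hp]; rfl
  have hv : ∀ g, p.right g = g := fun g => by
    by_contra H
    have := congrArg (fun x => (basis k G).repr x (p.right g, p.right 1)) (key g 1)
    simp [repr_elt, Ne.symm H] at this
  refine SemidirectProduct.ext ?_ (MulEquiv.ext hv)
  ext h g
  have := congrArg (fun x => (basis k G).repr x (g, h)) (key g h)
  simpa [repr_elt, hv] using this

end Fintype

/-! ### The cocentral projection onto the group algebra. -/

open Classical in
variable (k G) in
/-- The projection `D(G) → kG`, `e_g # h ↦ δ_{g,1} h`, as a linear map. -/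
def projLin : DrinfeldDouble k G →ₗ[k] MonoidAlgebra k G :=
  (basis k G).constr k fun x => if x.1 = 1 then MonoidAlgebra.single x.2 1 else 0

open Classical in
theorem projLin_elt (g h : G) :
    projLin k G (elt k g h) = if g = 1 then MonoidAlgebra.single h 1 else 0 :=
  (basis k G).constr_basis k _ (g, h)

theorem single_one_injective {a b : G}
    (H : (MonoidAlgebra.single a 1 : MonoidAlgebra k G) = MonoidAlgebra.single b 1) : a = b :=
  MonoidAlgebra.of_injective H

variable [Fintype G]

variable (k G) in
/-- The projection `D(G) → kG`, `e_g # h ↦ δ_{g,1} h`. -/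
def proj : DrinfeldDouble k G →ₐ[k] MonoidAlgebra k G :=
  AlgHom.ofLinearMap (projLin k G)
    (by classical simp [one_def, projLin_elt, MonoidAlgebra.one_def])
    (fun x y => by
      classical
      have : (LinearMap.mul k (DrinfeldDouble k G)).compr₂ (projLin k G) =
          (LinearMap.mul k (MonoidAlgebra k G)).compl₁₂ (projLin k G) (projLin k G) := by
        refine lin_ext fun g g' => lin_ext fun h h' => ?_
        simp only [LinearMap.compr₂_apply, LinearMap.compl₁₂_apply, LinearMap.mul_apply',
          elt_mul_elt, projLin_elt]
        by_cases hh : h = 1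
        · subst hh; by_cases hg : g = 1 <;> simp [hg, projLin_elt]
        · by_cases H : g = g' * h * g'⁻¹
          · subst H; simp [projLin_elt, hh]
          · simp [H, hh]
      exact LinearMap.congr_fun (LinearMap.congr_fun this x) y)

open Classical in
theorem proj_elt (g h : G) :
    proj k G (elt k g h) = if g = 1 then MonoidAlgebra.single h 1 else 0 := projLin_elt g h

/-- The projection `D(G) → kG` is cocentral. -/
theorem proj_cocentral (x : DrinfeldDouble k G) :
    TensorProduct.map (proj k G).toLinearMap LinearMap.id (CoalgebraStruct.comul (R := k) x) =
      TensorProduct.map (proj k G).toLinearMap LinearMap.id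
        (TensorProduct.comm k _ _ (CoalgebraStruct.comul (R := k) x)) := by
  classical
  have : TensorProduct.map (proj k G).toLinearMap LinearMap.id ∘ₗ
        CoalgebraStruct.comul (R := k) (A := DrinfeldDouble k G) =
      TensorProduct.map (proj k G).toLinearMap LinearMap.id ∘ₗ
        (TensorProduct.comm k _ _).toLinearMap ∘ₗ CoalgebraStruct.comul (R := k) := by
    refine lin_ext fun g h => ?_
    -- One term survives on each side, `x = g` or `x = 1`, and both give `h ⊗ (e_g # h)`.
    have e : ∀ x : G, x⁻¹ * g = 1 ↔ x = g := fun x => by rw [inv_mul_eq_one]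
    simp [comul_elt, proj_elt, e, TensorProduct.ite_tmul]
  exact LinearMap.congr_fun this x

/-! ### Automorphisms respect the grading by the second index. -/

section Classification

variable (f : DrinfeldDouble k G ≃ₐc[k] DrinfeldDouble k G)

theorem map_elt_ne_zero (g h : G) : f (elt k g h) ≠ 0 := fun H =>
  elt_ne_zero g h (f.injective (H.trans (map_zero f).symm))

theorem comul_map (x : DrinfeldDouble k G) :
    CoalgebraStruct.comul (R := k) (f x) =
      TensorProduct.map (f : DrinfeldDouble k G →ₗ[k] DrinfeldDouble k G)
        (f : DrinfeldDouble k G →ₗ[k] DrinfeldDouble k G) (CoalgebraStruct.comul (R := k) x) :=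
  (CoalgHomClass.map_comp_comul_apply f x).symm

theorem proj_map_conj (g h x : G) :
    proj k G (f (elt k (x⁻¹ * g) h)) = proj k G (f (elt k (g * x⁻¹) h)) := by
  classical
  have H := proj_cocentral (f (elt k g h))
  simp only [comul_map, comul_elt, map_sum, TensorProduct.map_tmul, TensorProduct.comm_tmul] at H
  -- Undoing `f` in the second factor lets a coordinate functional select a single term of each sum.
  have H2 := congrArg ((TensorProduct.rid k (MonoidAlgebra k G)).toLinearMap ∘ₗ
    TensorProduct.map LinearMap.id ((basis k G).coord (x, h) ∘ₗ
      (f.symm : DrinfeldDouble k G →ₗ[k] DrinfeldDouble k G))) H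
  have e : ∀ y : G, y⁻¹ * g = x ↔ y = g * x⁻¹ := fun y => by
    constructor
    · rintro rfl; group
    · rintro rfl; group
  simpa [repr_elt, e] using H2

/-- A conjugate `x g x⁻¹ ≠ g` has the same image, so the idempotent `π f(e_g # 1)` equals a product
of images of orthogonal idempotents. -/
theorem proj_map_one (hG : Subgroup.center G = ⊥) {g : G} (hg : g ≠ 1) :
    proj k G (f (elt k g 1)) = 0 := by
  classical
  obtain ⟨x, hx⟩ : ∃ x, x * g ≠ g * x := by
    by_contra! H
    exact hg (by simpa [hG] using Subgroup.mem_center_iff.2 H)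
  have h1 := proj_map_conj f (x * g) 1 x
  rw [inv_mul_cancel_left] at h1
  have h2 : elt k g 1 * elt k g 1 = elt k g 1 := by simp [elt_mul_elt]
  have h3 : elt k g 1 * elt k (x * g * x⁻¹) 1 = 0 := by
    rw [elt_mul_elt, if_neg]
    simpa [eq_mul_inv_iff_mul_eq] using Ne.symm hx
  rw [← h2, map_mul, map_mul]
  nth_rw 2 [h1]
  rw [← map_mul, ← map_mul, h3, map_zero, map_zero]

theorem elt_one_mul (g h : G) : elt k g 1 * elt k g h = elt k g h := by
  classical simp [elt_mul_elt]

theorem proj_map (hG : Subgroup.center G = ⊥) {g : G} (hg : g ≠ 1) (h : G) :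
    proj k G (f (elt k g h)) = 0 := by
  rw [← elt_one_mul, map_mul, map_mul, proj_map_one f hG hg, zero_mul]

/-- In the `kG`-coaction `(id ⊗ π)Δ`, the element `e_a # b` is homogeneous of degree `b`. -/
theorem coord_proj_comul (x : DrinfeldDouble k G) (a b : G) :
    TensorProduct.lid k (MonoidAlgebra k G)
      (TensorProduct.map ((basis k G).coord (a, b)) (proj k G).toLinearMap
        (CoalgebraStruct.comul (R := k) x)) =
      (basis k G).repr x (a, b) • MonoidAlgebra.single b 1 := by
  classical
  have : (TensorProduct.lid k (MonoidAlgebra k G)).toLinearMap ∘ₗ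
      TensorProduct.map ((basis k G).coord (a, b)) (proj k G).toLinearMap ∘ₗ
        CoalgebraStruct.comul (R := k) =
      ((basis k G).coord (a, b)).smulRight (MonoidAlgebra.single b 1) := by
    refine lin_ext fun g h => ?_
    by_cases H : h = b
    · subst H; simp [comul_elt, proj_elt, repr_elt]
    · simp [comul_elt, proj_elt, repr_elt, H]
  exact LinearMap.congr_fun this x

/-- Computing the coaction on `f(e_g # h)` through `Δ(e_g # h)` leaves only the term `x = 1`, by
`proj_map`. Every `b` occurring in `f(e_g # h)` is thus `π f(e_1 # h)`, independently of `g`. -/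
theorem repr_map_smul (hG : Subgroup.center G = ⊥) (g h a b : G) :
    (basis k G).repr (f (elt k g h)) (a, b) • MonoidAlgebra.single b 1 =
      (basis k G).repr (f (elt k g h)) (a, b) • proj k G (f (elt k 1 h)) := by
  rw [← coord_proj_comul, comul_map, comul_elt]
  simp only [map_sum, TensorProduct.map_tmul, TensorProduct.lid_tmul]
  rw [Finset.sum_eq_single 1]
  · simp
  · intro x _ hx
    have := proj_map f hG hx h
    simp only [AlgHom.toLinearMap_apply]
    exact (congrArg _ this).trans (smul_zero _)
  · simp

theorem exists_repr_ne_zero {x : DrinfeldDouble k G} (hx : x ≠ 0) :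
    ∃ a b, (basis k G).repr x (a, b) ≠ 0 := by
  by_contra! H
  exact hx ((basis k G).ext_elem fun i => by simpa using H i.1 i.2)

theorem exists_hom (hG : Subgroup.center G = ⊥) :
    ∃ v : G →* G, ∀ g h a b, (basis k G).repr (f (elt k g h)) (a, b) ≠ 0 → b = v h := by
  classical
  have H : ∀ h, ∃ b, proj k G (f (elt k 1 h)) = MonoidAlgebra.single b 1 := fun h => by
    obtain ⟨a, b, hab⟩ := exists_repr_ne_zero (map_elt_ne_zero f 1 h)
    exact ⟨b, (smul_right_injective _ hab (repr_map_smul f hG 1 h a b)).symm⟩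
  choose v hv using H
  refine ⟨MonoidHom.mk' v fun h h' => single_one_injective (k := k) ?_, fun g h a b hab => ?_⟩
  · rw [← hv, ← one_mul (1 : k), ← MonoidAlgebra.single_mul_single, ← hv, ← hv, ← map_mul,
      ← map_mul, elt_mul_elt]
    simp
  · have := smul_right_injective _ hab (repr_map_smul f hG g h a b)
    exact single_one_injective (k := k) (this.trans (hv h))

theorem map_elt_eq_sum {v : G →* G}
    (hv : ∀ g h a b, (basis k G).repr (f (elt k g h)) (a, b) ≠ 0 → b = v h) (g h : G) :
    f (elt k g h) = ∑ a, (basis k G).repr (f (elt k g h)) (a, v h) • elt k a (v h) := by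
  classical
  conv_lhs => rw [← (basis k G).sum_repr (f (elt k g h)), Fintype.sum_prod_type]
  refine Finset.sum_congr rfl fun a _ => Finset.sum_eq_single _ (fun b _ hb => ?_) (by simp)
  rw [not_not.1 (mt (hv g h a b) hb), zero_smul]

open Classical in
theorem sum_smul_elt_one_mul (y : G → k) (c h : G) :
    (∑ a, y a • elt k a 1) * elt k c h = y c • elt k c h := by
  simp [Finset.sum_mul, elt_mul_elt]

open Classical in
theorem elt_one_mul_sum_smul (y : G → k) (c h : G) :
    elt k c 1 * (∑ a, y a • elt k a h) = y c • elt k c h := by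
  simp [Finset.mul_sum, elt_mul_elt]

theorem elt_one_mul_elt_one_of_ne {g g' : G} (H : g ≠ g') : elt k g 1 * elt k g' 1 = 0 := by
  classical simp [elt_mul_elt, H]

/-! ### Monomial form and identification of the coefficients. -/

theorem exists_perm {v : G →* G}
    (hv : ∀ g h a b, (basis k G).repr (f (elt k g h)) (a, b) ≠ 0 → b = v h) :
    ∃ w : G → G, Function.Injective w ∧ ∀ g, f (elt k g 1) = elt k (w g) 1 := by
  classical
  set y : G → G → k := fun g a => (basis k G).repr (f (elt k g 1)) (a, 1) with hy
  have hs : ∀ g, f (elt k g 1) = ∑ a, y g a • elt k a 1 := fun g => by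
    simpa using map_elt_eq_sum f hv g 1
  have hmul : ∀ g g' a, y g a * y g' a = if g = g' then y g a else 0 := fun g g' a => by
    have h1 : f (elt k g 1 * elt k g' 1) * elt k a 1 = (y g a * y g' a) • elt k a 1 := by
      rw [map_mul, mul_assoc, hs g', sum_smul_elt_one_mul, mul_smul_comm, hs g,
        sum_smul_elt_one_mul, smul_smul, mul_comm]
    by_cases H : g = g'
    · subst H
      rw [elt_one_mul, hs, sum_smul_elt_one_mul] at h1
      rw [if_pos rfl]
      exact (smul_left_injective k (elt_ne_zero a 1) h1).symm
    · rw [elt_one_mul_elt_one_of_ne H, map_zero, zero_mul] at h1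
      rw [if_neg H]
      exact (smul_eq_zero.1 h1.symm).resolve_right (elt_ne_zero a 1)
  have hex : ∀ g, ∃ a, y g a ≠ 0 := fun g => by
    by_contra! H
    exact map_elt_ne_zero f g 1 (by rw [hs]; simp [H])
  have huniq : ∀ {g g' a}, y g a ≠ 0 → y g' a ≠ 0 → g = g' := fun {g g' a} h h' => by
    by_contra H
    exact mul_ne_zero h h' (by rw [hmul, if_neg H])
  choose w hw using hex
  have hinj : Function.Injective w := fun g g' H => huniq (hw g) (H ▸ hw g')
  refine ⟨w, hinj, fun g => ?_⟩
  rw [hs, Finset.sum_eq_single (w g)]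
  · have := hmul g g (w g)
    rw [if_pos rfl] at this
    rw [mul_right_cancel₀ (hw g) (this.trans (one_mul _).symm), one_smul]
  · intro a _ ha
    -- By finiteness every index is some `w g'`, already in the support of `f(e_{g'} # 1)`; the
    -- supports are disjoint.
    obtain ⟨g', rfl⟩ := Finite.surjective_of_injective hinj a
    have : y g (w g') = 0 := by
      by_contra H
      exact ha (congrArg w (huniq (hw g') H))
    rw [this, zero_smul]
  · simp

/-- If an automorphism sends every `e_g # h` to a multiple of `e_{w g} # v h`,
then `w` is multiplicative and the coefficients are multiplicative in `g`. -/
theorem comul_monomial {w v : G → G} (hw : Function.Injective w) {l : G → G → k}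
    (hl : ∀ g h, f (elt k g h) = l g h • elt k (w g) (v h)) (hl0 : ∀ g h, l g h ≠ 0) (x g h : G) :
    w (x * g) = w x * w g ∧ l (x * g) h = l g h * l x h := by
  classical
  have H := comul_map f (elt k (x * g) h)
  rw [hl, map_smul, comul_elt, comul_elt] at H
  simp only [map_sum, TensorProduct.map_tmul] at H
  -- The second-factor coordinate at `(w x, v h)` picks out `y = x` in the sum over `y`, as `w` is
  -- injective.
  have H2 := congrArg ((TensorProduct.rid k (DrinfeldDouble k G)).toLinearMap ∘ₗ
    TensorProduct.map LinearMap.id ((basis k G).coord (w x, v h))) H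
  have e : ∀ y, f (elt k y h) = l y h • elt k (w y) (v h) := fun y => hl y h
  have H3 : l (x * g) h • elt k ((w x)⁻¹ * w (x * g)) (v h) =
      (l g h * l x h) • elt k (w g) (v h) := by
    simpa [e, repr_elt, hw.eq_iff, smul_smul, mul_comm] using H2
  have H4 := congrArg (fun y => (basis k G).repr y (w g, v h)) H3
  have H5 : (w x)⁻¹ * w (x * g) = w g := by
    by_contra hne
    simp [repr_elt, hne, hl0] at H4
  refine ⟨inv_mul_eq_iff_eq_mul.1 H5, ?_⟩
  simpa [repr_elt, H5] using H4

theorem map_elt_eq_smul {v : G →* G}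
    (hv : ∀ g h a b, (basis k G).repr (f (elt k g h)) (a, b) ≠ 0 → b = v h) {w : G → G}
    (hw : ∀ g, f (elt k g 1) = elt k (w g) 1) (g h : G) :
    f (elt k g h) = (basis k G).repr (f (elt k g h)) (w g, v h) • elt k (w g) (v h) := by
  conv_lhs => rw [← elt_one_mul, map_mul, hw, map_elt_eq_sum f hv g h, elt_one_mul_sum_smul]

theorem elt_mul_elt_self (g h h' : G) :
    elt k g h * elt k (h⁻¹ * g * h) h' = elt k g (h * h') := by
  classical
  rw [elt_mul_elt, if_pos (by group)]

theorem map_monomial_conj {v : G →* G} {w : G → G} {l : G → G → k}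
    (hl : ∀ g h, f (elt k g h) = l g h • elt k (w g) (v h)) (hl0 : ∀ g h, l g h ≠ 0)
    (g h h' : G) :
    w g = v h * w (h⁻¹ * g * h) * (v h)⁻¹ ∧ l g (h * h') = l g h * l (h⁻¹ * g * h) h' := by
  classical
  have H := congrArg f (elt_mul_elt_self (k := k) g h h')
  rw [map_mul, hl, hl, hl, smul_mul_smul_comm, elt_mul_elt] at H
  have e : w g = v h * w (h⁻¹ * g * h) * (v h)⁻¹ := by
    by_contra hne
    rw [if_neg hne, smul_zero] at H
    exact smul_ne_zero (hl0 _ _) (elt_ne_zero _ _) H.symm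
  rw [if_pos e, ← map_mul] at H
  exact ⟨e, (smul_left_injective k (elt_ne_zero _ _) H).symm⟩

theorem twistHom_surjective (hG : Subgroup.center G = ⊥) : Function.Surjective (twistHom k G) := by
  classical
  intro f
  obtain ⟨v, hv⟩ := exists_hom f hG
  obtain ⟨w, hwi, hw⟩ := exists_perm f hv
  set l : G → G → k := fun g h => (basis k G).repr (f (elt k g h)) (w g, v h)
  have hl : ∀ g h, f (elt k g h) = l g h • elt k (w g) (v h) := map_elt_eq_smul f hv hw
  have hl0 : ∀ g h, l g h ≠ 0 := fun g h H =>
    map_elt_ne_zero f g h (by rw [hl, H, zero_smul])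
  have hcom := comul_monomial f hwi hl hl0
  have hcon := map_monomial_conj f hl hl0
  -- Conjugation by `v h` and by `w h` agree on the image of `w`, which is all of `G`.
  obtain rfl : w = v := funext fun h => eq_of_conj_eq hG fun x => by
    obtain ⟨g, rfl⟩ := Finite.surjective_of_injective hwi x
    have h1 := (hcon (h * g * h⁻¹) h 1).1
    have e : h⁻¹ * (h * g * h⁻¹) * h = g := by group
    rw [e] at h1
    rw [← h1, mul_inv_eq_iff_eq_mul, ← (hcom _ _ 1).1, ← (hcom _ _ 1).1]
    simp
  have hl1 : ∀ x g h, l (x * g) h = l g h * l x h := fun x g h => (hcom x g h).2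
  have hl2 : ∀ g h h', l g (h * h') = l g h * l g h' := fun g h h' => by
    -- `l` is multiplicative in its first argument with commutative values, hence conjugation
    -- invariant there.
    rw [(hcon g h h').2, hl1, mul_comm (l h h'), ← hl1, mul_inv_cancel_left]
  let V : MulAut G := MulEquiv.ofBijective v ⟨hwi, Finite.surjective_of_injective hwi⟩
  let s : BCh k G := MonoidHom.mk' (fun h => MonoidHom.mk' (fun g => Units.mk0 (l g h) (hl0 g h))
      fun x g => Units.ext (by simp [hl1, mul_comm]))
    fun h h' => MonoidHom.ext fun g => Units.ext (by simp [hl2])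
  -- Acting by `V` on `s` compensates for the evaluation at `(v h, v g)`.
  refine ⟨⟨BCh.action k G V s, V⟩, bialgEquiv_ext fun g h => ?_⟩
  refine (twistHom_elt _ g h).trans ?_
  rw [hl, BCh.action_apply, MulAut.inv_apply_self, MulAut.inv_apply_self]
  rfl

end Classification

end DrinfeldDouble

end

theorem mainTheorem4 (k : Type*) [Field k] [IsAlgClosed k] [CharZero k]
    (G : Type*) [Group G] [Fintype G] (hG : Subgroup.center G = ⊥) :
    ∃ Φ : (BCh k G ⋊[BCh.action k G] MulAut G) ≃*
        (DrinfeldDouble k G ≃ₐc[k] DrinfeldDouble k G),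
      (∀ (v : MulAut G) (g h : G),
        Φ (SemidirectProduct.inr v) (DrinfeldDouble.elt k g h) =
          DrinfeldDouble.elt k (v g) (v h)) ∧
      (∀ (r : BCh k G) (g h : G),
        Φ (SemidirectProduct.inl r) (DrinfeldDouble.elt k g h) =
          (r h g : k) • DrinfeldDouble.elt k g h) ∧
      (∀ (r : BCh k G) (v : MulAut G),
        (Φ (SemidirectProduct.inr v))⁻¹ * Φ (SemidirectProduct.inl r) *
          Φ (SemidirectProduct.inr v) = Φ (SemidirectProduct.inl (r.twist v))) := by
  refine ⟨MulEquiv.ofBijective (DrinfeldDouble.twistHom k G)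
    ⟨DrinfeldDouble.twistHom_injective, DrinfeldDouble.twistHom_surjective hG⟩,
    fun v g h => ?_, fun r g h => ?_, fun r v => ?_⟩
  · exact (DrinfeldDouble.twistHom_elt _ g h).trans (by simp)
  · exact (DrinfeldDouble.twistHom_elt _ g h).trans (by simp)
  · rw [← map_inv, ← map_mul, ← map_mul, ← map_inv, ← SemidirectProduct.inl_aut_inv]
    rfl
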